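/- Let $\mathcal A$ be a complex unital Banach algebra. An element $x\in\mathcal A$ is quasinilpotent if its spectral radius is $0$. An element $a\in\mathcal A$ is generalized Drazin invertible, written $a\in\mathcal A^d$, if there is a (necessarily unique) $a^d\in\mathcal A$ with $a^d a a^d=a^d$, $aa^d=a^da$ and $a-a^2a^d$ quasinilpotent; in that case put $a^\pi=1-aa^d$. Let $a,b\in\mathcal A^d$ satisfy $aba^\pi=a^\pi b^\pi b a b^\pi a^\pi$, and suppose that at least one of the elements $$a^\pi b a^\pi,\quad a^\pi b,\quad b a^\pi,\quad aa^d b aa^d,\quad aa^d b,\quad b aa^d$$ is generalized Drazin invertible. Put $c=aa^d(a+b)$. Then $$a+b\in\mathcal A^d\iff c\in\mathcal A^d\iff (a+b)aa^d\in\mathcal A^d\iff aa^d(a+b)aa^d\in\mathcal A^d .$$ In this case $$\begin{aligned}(a+b)^d={}&c^d+\sum_{n=0}^\infty (b^d)^{n+1}a^na^\pi-\sum_{n=0}^\infty (b^d)^{n+1}a^na^\pi b c^d\\ &+\sum_{n=0}^\infty\sum_{k=0}^\infty (b^d)^{n+k+2}a^ka^\pi b aa^d c^nc^\pi+\sum_{n=0}^\infty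 b^\pi(a+b)^na^\pi b(c^d)^{n+2}\\ &-\sum_{n=0}^\infty\sum_{k=0}^\infty (b^d)^{k+1}a^{k+1}(a+b)^na^\pi b(c^d)^{n+2},\end{aligned}$$ where all the series converge unconditionally (the double series as families indexed by $(n,k)$). -/

import Mathlib

section GDrazin

variable {A : Type*} [NormedRing A] [NormedAlgebra ℂ A]

/-- Quasinilpotent elements: the spectral radius is zero. -/
def IsQuasinilpotent (a : A) : Prop := spectralRadius ℂ a = 0

/-- `x` is a generalized Drazin (Koliha–Drazin) inverse of `a`. -/
structure IsGDrazinInverse (a x : A) : Prop where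
  outer : x * a * x = x
  comm : a * x = x * a
  qnil : IsQuasinilpotent (a - a ^ 2 * x)

/-- The set of generalized Drazin invertible elements. -/
def IsGDrazinInvertible (a : A) : Prop := ∃ x : A, IsGDrazinInverse a x

open Classical in
/-- The generalized Drazin inverse of `a`; it takes the junk value `0` when `a` has none.
It does not depend on the choice, by `IsGDrazinInverse.unique`. -/
noncomputable def gDrazin (a : A) : A :=
  if h : IsGDrazinInvertible a then h.choose else 0

/-- The spectral idempotent `1 - a aᵈ` of `a`. -/
noncomputable def specIdem (a : A) : A := 1 - a * gDrazin a

theorem IsQuasinilpotent.tendsto_mul [CompleteSpace A] {a : A} (ha : IsQuasinilpotent a) (x : A) :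
    Filter.Tendsto (fun n : ℕ => ‖x‖ ^ n * ‖a ^ n‖) Filter.atTop (nhds 0) := by
  have h := spectrum.pow_nnnorm_pow_one_div_tendsto_nhds_spectralRadius a
  rw [show spectralRadius ℂ a = 0 from ha] at h
  have hr : (0 : ENNReal) < ENNReal.ofReal (1 / (2 * (‖x‖ + 1))) := by
    rw [ENNReal.ofReal_pos]; positivity
  have hb : ∀ᶠ n : ℕ in Filter.atTop, ‖x‖ ^ n * ‖a ^ n‖ ≤ (1 / 2 : ℝ) ^ n := by
    filter_upwards [h.eventually (gt_mem_nhds hr), Filter.eventually_gt_atTop 0] with n hn hn0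
    have h1 : ((‖a ^ n‖₊ : ENNReal)) ≤ ENNReal.ofReal (1 / (2 * (‖x‖ + 1))) ^ n := by
      have := ENNReal.rpow_le_rpow hn.le (Nat.cast_nonneg n : (0 : ℝ) ≤ n)
      rwa [← ENNReal.rpow_mul, one_div_mul_cancel (by positivity), ENNReal.rpow_one,
        ENNReal.rpow_natCast] at this
    have h2 : ‖a ^ n‖ ≤ (1 / (2 * (‖x‖ + 1))) ^ n := by
      rw [← ENNReal.ofReal_pow (by positivity)] at h1
      have := ENNReal.toReal_mono ENNReal.ofReal_ne_top h1
      rwa [ENNReal.toReal_ofReal (by positivity)] at this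
    calc ‖x‖ ^ n * ‖a ^ n‖ ≤ (‖x‖ + 1) ^ n * (1 / (2 * (‖x‖ + 1))) ^ n := by
          gcongr; linarith
      _ = (1 / 2 : ℝ) ^ n := by
          rw [← mul_pow]; congr 1; field_simp
  exact squeeze_zero' (Filter.Eventually.of_forall fun n => by positivity) hb
    (tendsto_pow_atTop_nhds_zero_of_lt_one (by norm_num) (by norm_num))

/-- Uniqueness of the generalized Drazin inverse. -/
theorem IsGDrazinInverse.unique [CompleteSpace A] {a x y : A}
    (hx : IsGDrazinInverse a x) (hy : IsGDrazinInverse a y) : x = y := by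
  have key : ∀ {x y : A}, IsGDrazinInverse a x → IsGDrazinInverse a y →
      a * x = a * x * (a * y) ∧ a * x = a * y * (a * x) := by
    intro x y hx hy
    have cx : Commute a x := hx.comm
    have cy : Commute a y := hy.comm
    have idx : IsIdempotentElem (a * x) := by
      unfold IsIdempotentElem; rw [mul_assoc, ← mul_assoc x, hx.outer]
    have idy : IsIdempotentElem (1 - a * y) := by
      apply IsIdempotentElem.one_sub
      unfold IsIdempotentElem; rw [mul_assoc, ← mul_assoc y, hy.outer]
    have cf : Commute a (1 - a * y) :=
      (Commute.one_right a).sub_right ((Commute.refl a).mul_right cy)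
    have hw : a - a ^ 2 * y = a * (1 - a * y) := by noncomm_ring
    have e1 : ∀ n : ℕ, a * x * (1 - a * y) = x ^ (n + 1) * (a - a ^ 2 * y) ^ (n + 1) := by
      intro n
      rw [hw, cf.mul_pow, ← mul_assoc, ← cx.symm.mul_pow, idy.pow_succ_eq, ← hx.comm,
        idx.pow_succ_eq]
    have e2 : ∀ n : ℕ, (1 - a * y) * (a * x) = (a - a ^ 2 * y) ^ (n + 1) * x ^ (n + 1) := by
      intro n
      rw [hw, cf.eq, cf.symm.mul_pow, mul_assoc, ← cx.mul_pow, idy.pow_succ_eq,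
        idx.pow_succ_eq]
    have lim := (hy.qnil.tendsto_mul x).comp (Filter.tendsto_add_atTop_nat 1)
    have z1 : a * x * (1 - a * y) = 0 := by
      rw [← norm_le_zero_iff]
      refine ge_of_tendsto' lim fun n => ?_
      rw [e1 n]
      exact (norm_mul_le _ _).trans
        (mul_le_mul_of_nonneg_right (norm_pow_le' x n.succ_pos) (norm_nonneg _))
    have z2 : (1 - a * y) * (a * x) = 0 := by
      rw [← norm_le_zero_iff]
      refine ge_of_tendsto' lim fun n => ?_
      rw [e2 n, Function.comp, mul_comm]
      exact (norm_mul_le _ _).trans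
        (mul_le_mul_of_nonneg_left (norm_pow_le' x n.succ_pos) (norm_nonneg _))
    rw [mul_sub, mul_one, sub_eq_zero] at z1
    rw [sub_mul, one_mul, sub_eq_zero] at z2
    exact ⟨z1, z2⟩
  have hp : a * x = a * y := (key hx hy).1.trans (key hy hx).2.symm
  calc x = x * (a * x) := by rw [← mul_assoc, hx.outer]
    _ = x * (a * y) := by rw [hp]
    _ = a * x * y := by rw [← mul_assoc, ← hx.comm]
    _ = y := by rw [hp, hy.comm, hy.outer]

theorem IsGDrazinInvertible.isGDrazinInverse_gDrazin {a : A} (h : IsGDrazinInvertible a) :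
    IsGDrazinInverse a (gDrazin a) := by
  rw [gDrazin, dif_pos h]; exact h.choose_spec

end GDrazin

/-! Put `p = a aᵈ`, `q = 1 - p`, and write `π` for spectral idempotents. The hypothesis kills `p a b
q`, and `aᵈ` cancels `a` under `p`, so `p b q = 0`: relative to `p`, the element `a` is diagonal and
`b`, hence `a + b`, is triangular, with diagonal entries `c` and `(a + b) q`.

Any of the six alternatives makes `b q` invertible in the generalized Drazin sense, by Cline's
formula and triangularity, and its inverse is then `bᵈ q`. On the corner of `q` the quasinilpotent
`a q` satisfies the hypothesis relative to `b q`. There `(a q)(bᵈ q) = 0`, and `(b q)^π (a + b) q`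
is a sum of two commuting quasinilpotents, so `(a + b) q` always has the inverse `T = ∑ (bᵈ)^(n+1)
aⁿ q` (`QnilPerturbation.isGDrazinInverse_add`).

A triangular element with invertible diagonal entries is invertible, with an explicit off-diagonal
series (`isGDrazinInverse_of_triangular`); conversely, if `a + b` and `(a + b) q` are invertible, so
is `c` (`IsGDrazinInverse.corestrict_of_restrict`). The stated formula follows by inserting `T^(n+2)
= (bᵈ)^(n+1) T` and the expansion of `1 - (a + b) q T` into the off-diagonal series. The other
equivalences are Cline's formula and `c = c p`.

Convergence and all vanishing arguments rest on one fact: an element is quasinilpotent exactly when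
its powers decay faster than every geometric sequence. -/

/-! ### Sequences of superexponential decay. -/

section GeometricDecay

variable {A : Type*} [NormedRing A]

/-- A sequence that decays faster than every geometric sequence. -/
def GeomSmall (u : ℕ → A) : Prop := ∀ r : ℝ, 0 < r → ∃ C : ℝ, ∀ n, ‖u n‖ ≤ C * r ^ n

theorem GeomSmall.exists_nonneg {u : ℕ → A} (hu : GeomSmall u) {r : ℝ} (hr : 0 < r) :
    ∃ C : ℝ, 0 ≤ C ∧ ∀ n, ‖u n‖ ≤ C * r ^ n := by
  obtain ⟨C, hC⟩ := hu r hr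
  refine ⟨C, ?_, hC⟩
  simpa using (norm_nonneg _).trans (hC 0)

theorem GeomSmall.mul_left {u : ℕ → A} (hu : GeomSmall u) (x : A) :
    GeomSmall (fun n => x * u n) := by
  intro r hr
  obtain ⟨C, hC⟩ := hu r hr
  refine ⟨‖x‖ * C, fun n => (norm_mul_le _ _).trans ?_⟩
  rw [mul_assoc]
  exact mul_le_mul_of_nonneg_left (hC n) (norm_nonneg _)

theorem GeomSmall.mul_right {u : ℕ → A} (hu : GeomSmall u) (x : A) :
    GeomSmall (fun n => u n * x) := by
  intro r hr
  obtain ⟨C, hC⟩ := hu r hr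
  refine ⟨C * ‖x‖, fun n => (norm_mul_le _ _).trans ?_⟩
  rw [mul_right_comm]
  exact mul_le_mul_of_nonneg_right (hC n) (norm_nonneg _)

theorem GeomSmall.shift {u : ℕ → A} (hu : GeomSmall u) : GeomSmall (fun n => u (n + 1)) := by
  intro r hr
  obtain ⟨C, hC⟩ := hu r hr
  refine ⟨C * r, fun n => (hC (n + 1)).trans_eq ?_⟩
  ring

/-- Power identities involving idempotents often hold only from exponent one on; a larger constant
absorbs the term at zero. -/
theorem GeomSmall.of_shift {u : ℕ → A} (hu : GeomSmall (fun n => u (n + 1))) : GeomSmall u := by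
  intro r hr
  obtain ⟨C, hC⟩ := hu r hr
  refine ⟨max ‖u 0‖ (C / r), fun n => ?_⟩
  cases n with
  | zero => simp
  | succ n =>
    calc ‖u (n + 1)‖ ≤ C * r ^ n := hC n
      _ = C / r * r ^ (n + 1) := by field_simp; ring
      _ ≤ _ := mul_le_mul_of_nonneg_right (le_max_right _ _) (by positivity)

theorem GeomSmall.summable {u : ℕ → A} (hu : GeomSmall u) {K : ℝ} (hK : 0 ≤ K) :
    Summable (fun n => K ^ n * ‖u n‖) := by
  -- The ratio makes `(K + 1) * r = 1 / 2`; using `K + 1` allows `K = 0`.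
  obtain ⟨C, hC⟩ := hu (1 / (2 * (K + 1))) (by positivity)
  have hle : ∀ n, K ^ n * ‖u n‖ ≤ C * (1 / 2 : ℝ) ^ n := fun n => by
    calc K ^ n * ‖u n‖ ≤ (K + 1) ^ n * (C * (1 / (2 * (K + 1))) ^ n) := by
          gcongr
          · linarith
          · exact hC n
      _ = C * ((K + 1) * (1 / (2 * (K + 1)))) ^ n := by rw [mul_pow]; ring
      _ = C * (1 / 2 : ℝ) ^ n := by congr 2; field_simp
  exact Summable.of_nonneg_of_le (fun n => by positivity) hle
    ((summable_geometric_of_lt_one (by norm_num) (by norm_num)).mul_left C)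

theorem GeomSmall.eq_zero {u : ℕ → A} (hu : GeomSmall u) {w : A} {D K : ℝ} (hK : 0 ≤ K)
    (h : ∀ n, ‖w‖ ≤ D * (K ^ n * ‖u n‖)) : w = 0 := by
  have ht := (hu.summable hK).tendsto_atTop_zero.const_mul D
  rw [mul_zero] at ht
  exact norm_le_zero_iff.1 (ge_of_tendsto' ht h)

theorem norm_pow_succ_le (x : A) (n : ℕ) : ‖x ^ (n + 1)‖ ≤ ‖x‖ * ‖x‖ ^ n :=
  (norm_pow_le' x n.succ_pos).trans_eq (pow_succ' _ _)

/-- The vanishing principle behind compatibility of inverses: a fixed element with such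
factorizations for all `n` is bounded by a null sequence. -/
theorem GeomSmall.eq_zero_of_pow_mul {u : ℕ → A} (hu : GeomSmall u) {w x : A}
    (h : ∀ n, w = x ^ (n + 1) * u n) : w = 0 := by
  refine hu.eq_zero (D := ‖x‖) (norm_nonneg x) fun n => ?_
  rw [← mul_assoc]
  conv_lhs => rw [h n]
  exact (norm_mul_le _ _).trans
    (mul_le_mul_of_nonneg_right (norm_pow_succ_le x n) (norm_nonneg _))

theorem GeomSmall.eq_zero_of_mul_pow {u : ℕ → A} (hu : GeomSmall u) {w x : A}
    (h : ∀ n, w = u n * x ^ (n + 1)) : w = 0 := by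
  refine hu.eq_zero (D := ‖x‖) (norm_nonneg x) fun n => ?_
  rw [← mul_assoc]
  conv_lhs => rw [h n]
  rw [mul_comm _ ‖u n‖]
  exact (norm_mul_le _ _).trans
    (mul_le_mul_of_nonneg_left (norm_pow_succ_le x n) (norm_nonneg _))

theorem GeomSmall.summable_pow_mul_norm {u : ℕ → A} (hu : GeomSmall u) (x : A) :
    Summable (fun n => ‖x ^ (n + 1) * u n‖) := by
  refine Summable.of_nonneg_of_le (fun n => norm_nonneg _) (fun n => ?_)
    ((hu.summable (norm_nonneg x)).mul_left ‖x‖)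
  rw [← mul_assoc]
  exact (norm_mul_le _ _).trans
    (mul_le_mul_of_nonneg_right (norm_pow_succ_le x n) (norm_nonneg _))

theorem GeomSmall.summable_mul_pow_norm {u : ℕ → A} (hu : GeomSmall u) (x : A) :
    Summable (fun n => ‖u n * x ^ (n + 1)‖) := by
  refine Summable.of_nonneg_of_le (fun n => norm_nonneg _) (fun n => ?_)
    ((hu.summable (norm_nonneg x)).mul_left ‖x‖)
  rw [← mul_assoc, mul_comm _ ‖u n‖]
  exact (norm_mul_le _ _).trans
    (mul_le_mul_of_nonneg_left (norm_pow_succ_le x n) (norm_nonneg _))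

theorem GeomSmall.of_norm_le_sum_choose {u v w : ℕ → A} (hu : GeomSmall u) (hv : GeomSmall v)
    (h : ∀ n, ‖w n‖ ≤ ∑ i ∈ Finset.range (n + 1), ‖u i‖ * ‖v (n - i)‖ * (n.choose i : ℝ)) :
    GeomSmall w := by
  intro r hr
  -- Ratio `r / 2` for both factors, so that the binomial theorem sums to `r ^ n`.
  obtain ⟨C, hC0, hC⟩ := hu.exists_nonneg (half_pos hr)
  obtain ⟨D, hD0, hD⟩ := hv.exists_nonneg (half_pos hr)
  refine ⟨C * D, fun n => (h n).trans ?_⟩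
  have hr' : r = r / 2 + r / 2 := by ring
  calc ∑ i ∈ Finset.range (n + 1), ‖u i‖ * ‖v (n - i)‖ * (n.choose i : ℝ)
      ≤ ∑ i ∈ Finset.range (n + 1),
          C * D * ((r / 2) ^ i * (r / 2) ^ (n - i) * (n.choose i : ℝ)) := by
        refine Finset.sum_le_sum fun i _ => ?_
        calc ‖u i‖ * ‖v (n - i)‖ * (n.choose i : ℝ)
            ≤ (C * (r / 2) ^ i) * (D * (r / 2) ^ (n - i)) * (n.choose i : ℝ) := by
              gcongr
              · exact hC i
              · exact hD _
          _ = _ := by ring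
    _ = C * D * r ^ n := by rw [← Finset.mul_sum, ← add_pow, ← hr']

end GeometricDecay

/-! ### Quasinilpotent elements: characterization by decay, products and sums. -/

section Quasinilpotent

variable {A : Type*} [NormedRing A] [NormedAlgebra ℂ A] [CompleteSpace A]

theorem IsQuasinilpotent.geomSmall {a : A} (ha : IsQuasinilpotent a) :
    GeomSmall (fun n => a ^ n) := by
  intro r hr
  rcases subsingleton_or_nontrivial A with hA | hA
  · exact ⟨0, fun n => by
      rw [Subsingleton.elim ((fun n => a ^ n) n) 0]; simp⟩
  -- A scalar of norm at least `r⁻¹`; the norm of `1` may exceed one, and is at least one only in a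
  -- nontrivial algebra.
  set x : A := algebraMap ℂ A ((r⁻¹ : ℝ) : ℂ) with hx
  have hxr : r⁻¹ ≤ ‖x‖ := by
    rw [hx, norm_algebraMap, Complex.norm_real, Real.norm_of_nonneg (by positivity)]
    exact le_mul_of_one_le_right (by positivity) (one_le_norm_one A)
  obtain ⟨C, hC⟩ := (ha.tendsto_mul x).bddAbove_range
  refine ⟨C, fun n => ?_⟩
  have h1 : (r⁻¹) ^ n * ‖a ^ n‖ ≤ C :=
    (mul_le_mul_of_nonneg_right (pow_le_pow_left₀ (by positivity) hxr n) (norm_nonneg _)).trans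
      (hC ⟨n, rfl⟩)
  rw [inv_pow, inv_mul_le_iff₀ (by positivity)] at h1
  linarith

/-- If `k ≠ 0` is in the spectrum, `k ^ n` is in that of `a ^ n`; decay at ratio `‖k‖ / 2` would
then bound `2 ^ n`. -/
theorem isQuasinilpotent_of_geomSmall {a : A} (ha : GeomSmall (fun n => a ^ n)) :
    IsQuasinilpotent a := by
  unfold IsQuasinilpotent spectralRadius
  simp only [ENNReal.iSup_eq_zero, ENNReal.coe_eq_zero, nnnorm_eq_zero]
  intro k hk
  have hz : (k : ℂ) = 0 := by
    by_contra hk0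
    have hkpos : 0 < ‖k‖ := norm_pos_iff.2 hk0
    obtain ⟨C, hC⟩ := ha (‖k‖ / 2) (by positivity)
    have hbd : ∀ n : ℕ, (2 : ℝ) ^ n ≤ C * ‖(1 : A)‖ := fun n => by
      have h1 := spectrum.norm_le_norm_mul_of_mem (spectrum.pow_mem_pow a n hk)
      rw [norm_pow] at h1
      have h2 : ‖k‖ ^ n ≤ C * (‖k‖ / 2) ^ n * ‖(1 : A)‖ :=
        h1.trans (mul_le_mul_of_nonneg_right (hC n) (norm_nonneg _))
      rw [div_pow] at h2
      have h3 : ‖k‖ ^ n * 2 ^ n ≤ ‖k‖ ^ n * (C * ‖(1 : A)‖) := by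
        calc ‖k‖ ^ n * 2 ^ n ≤ C * (‖k‖ ^ n / 2 ^ n) * ‖(1 : A)‖ * 2 ^ n :=
              mul_le_mul_of_nonneg_right h2 (by positivity)
          _ = _ := by field_simp
      exact le_of_mul_le_mul_left h3 (by positivity)
    obtain ⟨n, hn⟩ := pow_unbounded_of_one_lt (C * ‖(1 : A)‖) (one_lt_two : (1 : ℝ) < 2)
    exact absurd (hbd n) (not_le.2 hn)
  exact hz

theorem IsQuasinilpotent.mul_swap {u v : A} (h : IsQuasinilpotent (u * v)) :
    IsQuasinilpotent (v * u) := by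
  refine isQuasinilpotent_of_geomSmall (GeomSmall.of_shift ?_)
  have hp : ∀ n, (v * u) ^ (n + 1) = v * (u * v) ^ n * u := fun n => by
    induction n with
    | zero => simp
    | succ n ih => rw [pow_succ, ih, pow_succ]; simp only [mul_assoc]
  simp only [hp]
  exact (h.geomSmall.mul_left v).mul_right u

theorem IsQuasinilpotent.add_of_commute {u v : A} (hu : IsQuasinilpotent u)
    (hv : IsQuasinilpotent v) (h : Commute u v) : IsQuasinilpotent (u + v) := by
  refine isQuasinilpotent_of_geomSmall
    (GeomSmall.of_norm_le_sum_choose hu.geomSmall hv.geomSmall fun n => ?_)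
  rw [h.add_pow]
  refine (norm_sum_le _ _).trans (Finset.sum_le_sum fun i _ => ?_)
  rw [← nsmul_eq_mul']
  refine norm_nsmul_le.trans ?_
  rw [mul_comm]
  exact mul_le_mul_of_nonneg_right (norm_mul_le _ _) (Nat.cast_nonneg _)

/-- Only the words `v ^ i * u ^ (n - i)` survive in the expansion; their coefficients are at most
the binomial ones. -/
theorem IsQuasinilpotent.add_of_mul_eq_zero {u v : A} (hu : IsQuasinilpotent u)
    (hv : IsQuasinilpotent v) (h : u * v = 0) : IsQuasinilpotent (u + v) := by
  have hp : ∀ n, (u + v) ^ n = ∑ i ∈ Finset.range (n + 1), v ^ i * u ^ (n - i) := fun n => by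
    induction n with
    | zero => simp
    | succ n ih =>
      have h0 : u * ∑ i ∈ Finset.range (n + 1), v ^ i * u ^ (n - i) = u ^ (n + 1) := by
        rw [Finset.sum_range_succ', mul_add, Finset.mul_sum, Finset.sum_eq_zero]
        · rw [pow_zero, one_mul, zero_add, Nat.sub_zero, pow_succ']
        · intro i _
          rw [pow_succ', mul_assoc v, ← mul_assoc u, h, zero_mul]
      rw [pow_succ', ih, add_mul, h0, Finset.sum_range_succ' _ (n + 1), Finset.mul_sum, add_comm]
      congr 1
      · refine Finset.sum_congr rfl fun i _ => ?_
        rw [Nat.add_sub_add_right, pow_succ', mul_assoc]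
      · simp
  refine isQuasinilpotent_of_geomSmall
    (GeomSmall.of_norm_le_sum_choose hv.geomSmall hu.geomSmall fun n => ?_)
  rw [hp]
  refine (norm_sum_le _ _).trans (Finset.sum_le_sum fun i hi => (norm_mul_le _ _).trans ?_)
  refine le_mul_of_one_le_right (by positivity) ?_
  exact_mod_cast Nat.choose_pos (Nat.lt_succ_iff.1 (Finset.mem_range.1 hi))

end Quasinilpotent

theorem pow_mul_idem {R : Type*} [Monoid R] {q m : R} (hq : IsIdempotentElem q)
    (h : q * (m * q) = m * q) (n : ℕ) :
    m ^ n * q = (m * q) ^ n * q := by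
  induction n with
  | zero => simp
  | succ n ih =>
    rw [pow_succ, mul_assoc]
    conv_lhs => rw [← h, ← mul_assoc, ih, mul_assoc, h]
    rw [pow_succ, mul_assoc, mul_assoc m, hq.eq]

/-! ### Algebra of generalized Drazin inverses, Cline's formula, restriction and quotient. -/

section GDrazinInverse

variable {A : Type*} [NormedRing A] [NormedAlgebra ℂ A]

namespace IsGDrazinInverse

variable {a x : A}

theorem outer' (h : IsGDrazinInverse a x) : x * (a * x) = x := by
  rw [← mul_assoc, h.outer]

theorem mul_mul_self (h : IsGDrazinInverse a x) : a * (x * x) = x := by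
  rw [← mul_assoc, h.comm, h.outer]

theorem self_mul_mul (h : IsGDrazinInverse a x) : x * (x * a) = x := by
  rw [← h.comm, h.outer']

theorem pow_mul_pow (h : IsGDrazinInverse a x) (n : ℕ) : a ^ n * x ^ (n + 1) = x := by
  induction n with
  | zero => simp
  | succ n ih =>
    rw [pow_succ a, pow_succ' x (n + 1), pow_succ' x n]
    calc a ^ n * a * (x * (x * x ^ n)) = a ^ n * (a * (x * x)) * x ^ n := by
          simp only [mul_assoc]
      _ = x := by rw [h.mul_mul_self, mul_assoc, ← pow_succ', ih]

theorem pow_mul_pow' (h : IsGDrazinInverse a x) (n : ℕ) : x ^ (n + 1) * a ^ n = x := by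
  have hc : Commute a x := h.comm
  rw [← (hc.pow_pow n (n + 1)).eq, h.pow_mul_pow]

theorem pow_succ_mul (h : IsGDrazinInverse a x) (n : ℕ) : x ^ (n + 2) * a = x ^ (n + 1) := by
  rw [pow_succ x (n + 1), pow_succ x n, mul_assoc, mul_assoc, h.self_mul_mul]

theorem mul_pow_succ (h : IsGDrazinInverse a x) (n : ℕ) : a * x ^ (n + 2) = x ^ (n + 1) := by
  have hc : Commute a x := h.comm
  rw [(hc.pow_right (n + 2)).eq, h.pow_succ_mul]

theorem commute_one_sub (h : IsGDrazinInverse a x) : Commute a (1 - a * x) := by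
  have hc : Commute a x := h.comm
  exact (Commute.one_right a).sub_right ((Commute.refl a).mul_right hc)

theorem isIdempotentElem_one_sub (h : IsGDrazinInverse a x) :
    IsIdempotentElem (1 - a * x) := by
  apply IsIdempotentElem.one_sub
  rw [IsIdempotentElem, mul_assoc, h.outer']

theorem mul_one_sub (h : IsGDrazinInverse a x) : x * (1 - a * x) = 0 := by
  rw [mul_sub, mul_one, h.outer', sub_self]

theorem one_sub_mul (h : IsGDrazinInverse a x) : (1 - a * x) * x = 0 := by
  rw [sub_mul, one_mul, mul_assoc, h.mul_mul_self, sub_self]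

theorem pow_succ_mul_one_sub (h : IsGDrazinInverse a x) (n : ℕ) :
    (a - a ^ 2 * x) ^ (n + 1) = a ^ (n + 1) * (1 - a * x) := by
  have e : a - a ^ 2 * x = a * (1 - a * x) := by noncomm_ring
  rw [e, h.commute_one_sub.mul_pow, h.isIdempotentElem_one_sub.pow_succ_eq]

variable [CompleteSpace A]

/-- From exponent one on these are the powers of the quasinilpotent part of `a`. -/
theorem geomSmall (h : IsGDrazinInverse a x) : GeomSmall (fun n => a ^ n * (1 - a * x)) := by
  refine GeomSmall.of_shift ?_
  simp only [← h.pow_succ_mul_one_sub]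
  exact h.qnil.geomSmall.shift

theorem geomSmall' (h : IsGDrazinInverse a x) : GeomSmall (fun n => (1 - a * x) * a ^ n) := by
  have := h.geomSmall
  simpa only [(h.commute_one_sub.pow_left _).eq] using this

theorem gDrazin_eq (h : IsGDrazinInverse a x) : gDrazin a = x :=
  (IsGDrazinInvertible.isGDrazinInverse_gDrazin ⟨x, h⟩).unique h

/-- Cline's formula. -/
theorem cline {u v d : A} (h : IsGDrazinInverse (u * v) d) :
    IsGDrazinInverse (v * u) (v * (d * d) * u) := by
  have e1 : v * u * (v * (d * d) * u) = v * d * u := by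
    rw [show v * u * (v * (d * d) * u) = v * (u * v * (d * d)) * u by noncomm_ring,
      h.mul_mul_self]
  refine ⟨?_, ?_, ?_⟩
  · rw [mul_assoc, e1, show v * (d * d) * u * (v * d * u) = v * (d * (d * (u * v)) * d) * u by
      noncomm_ring, h.self_mul_mul]
  · rw [e1, show v * (d * d) * u * (v * u) = v * (d * (d * (u * v))) * u by noncomm_ring,
      h.self_mul_mul]
  · have e2 : v * u - (v * u) ^ 2 * (v * (d * d) * u) = v * ((1 - u * v * d) * u) := by
      rw [pow_two, mul_assoc (v * u), e1]; noncomm_ring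
    rw [e2]
    -- Moving `v` to the other side turns this into the quasinilpotent part of `u * v`.
    refine IsQuasinilpotent.mul_swap ?_
    have e3 : (1 - u * v * d) * u * v = u * v - (u * v) ^ 2 * d := by
      rw [mul_assoc, ← h.commute_one_sub.eq]; noncomm_ring
    rw [e3]
    exact h.qnil

end IsGDrazinInverse

variable [CompleteSpace A]

theorem IsQuasinilpotent.mul_idem {g t : A} (ht : IsQuasinilpotent t) (h : t * g = g * t * g) :
    IsQuasinilpotent (t * g) := by
  have hp : ∀ n, (t * g) ^ (n + 1) = t ^ (n + 1) * g := fun n => by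
    induction n with
    | zero => simp
    | succ n ih =>
      rw [pow_succ, ih, pow_succ t (n + 1), mul_assoc, mul_assoc, ← mul_assoc g, ← h]
  refine isQuasinilpotent_of_geomSmall (GeomSmall.of_shift ?_)
  simp only [hp]
  exact ht.geomSmall.shift.mul_right g

theorem IsQuasinilpotent.idem_mul {g t : A} (ht : IsQuasinilpotent t) (h : g * t = g * t * g) :
    IsQuasinilpotent (g * t) := by
  have hp : ∀ n, (g * t) ^ (n + 1) = g * t ^ (n + 1) := fun n => by
    induction n with
    | zero => simp
    | succ n ih =>
      rw [pow_succ', ih, pow_succ' t (n + 1), ← mul_assoc, ← mul_assoc, ← h]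
  refine isQuasinilpotent_of_geomSmall (GeomSmall.of_shift ?_)
  simp only [hp]
  exact ht.geomSmall.shift.mul_left g

namespace IsGDrazinInverse

variable {a x : A}

/-- Restriction to the range of an idempotent that is invariant under both elements. -/
theorem restrict {g : A} (h : IsGDrazinInverse a x)
    (ha : a * g = g * a * g) (hx : x * g = g * x * g) :
    IsGDrazinInverse (a * g) (x * g) := by
  have ha1 : g * (a * g) = a * g := by rw [← mul_assoc, ← ha]
  have hx1 : g * (x * g) = x * g := by rw [← mul_assoc, ← hx]
  have ha' : ∀ y : A, g * (a * (g * y)) = a * (g * y) := fun y => by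
    rw [← mul_assoc a, ← mul_assoc, ha1]
  have e1 : a * g * (x * g) = a * x * g := by simp only [mul_assoc, hx1]
  have e2 : x * g * (a * g) = x * a * g := by simp only [mul_assoc, ha1]
  have e3 : a * g - (a * g) ^ 2 * (x * g) = (a - a ^ 2 * x) * g := by
    rw [pow_two, mul_assoc, e1, mul_assoc a x, mul_assoc a g, ← hx1, ha', hx1]
    simp only [sub_mul, pow_two, mul_assoc]
  refine ⟨?_, ?_, ?_⟩
  · rw [e2, mul_assoc, hx1, ← mul_assoc, h.outer]
  · rw [e1, e2, h.comm]
  · rw [e3]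
    refine h.qnil.mul_idem ?_
    rw [mul_assoc, ← e3, mul_sub, ha1, pow_two, mul_assoc (a * g), ← mul_assoc g (a * g), ha1]

/-- Passage to the quotient by the kernel of an idempotent that is invariant under both
elements. -/
theorem corestrict {g : A} (h : IsGDrazinInverse a x)
    (ha : g * a = g * a * g) (hx : g * x = g * x * g) :
    IsGDrazinInverse (g * a) (g * x) := by
  have e1 : g * a * (g * x) = g * (a * x) := by rw [← mul_assoc, ← ha, mul_assoc]
  have e2 : g * x * (g * a) = g * (x * a) := by rw [← mul_assoc, ← hx, mul_assoc]
  have e3 : g * a - (g * a) ^ 2 * (g * x) = g * (a - a ^ 2 * x) := by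
    rw [pow_two, mul_assoc, e1, ← mul_assoc, ← ha]; noncomm_ring
  refine ⟨?_, ?_, ?_⟩
  · rw [mul_assoc, e1, ← mul_assoc, ← hx, mul_assoc, h.outer']
  · rw [e1, e2, h.comm]
  · rw [e3]
    refine h.qnil.idem_mul ?_
    rw [← e3, sub_mul, ← ha]
    congr 1
    rw [mul_assoc, ← hx]

end IsGDrazinInverse

end GDrazinInverse

/-! ### Triangular elements. -/

section Triangular

variable {A : Type*} [NormedRing A] [NormedAlgebra ℂ A]

namespace IsGDrazinInverse

variable {a x g : A}

theorem idem_mul (h : IsGDrazinInverse a x) (hg : g * a = a) : g * x = x := by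
  rw [← h.mul_mul_self, ← mul_assoc, hg]

theorem mul_idem (h : IsGDrazinInverse a x) (hg : a * g = a) : x * g = x := by
  rw [← h.self_mul_mul, mul_assoc, mul_assoc, hg]

variable [CompleteSpace A]

/-- Invariance of the range of `g` under `u` is not assumed but forced. Both `u * (g * (1 - m * g *
y))` and `(1 - m * u) * y` vanish by superexponential decay, so `u * g` and `y` both equal `u * m *
y`. -/
theorem mul_eq_of_restrict {m u y : A} (hg : IsIdempotentElem g) (hm : m * g = g * m * g)
    (h : IsGDrazinInverse m u) (hy : IsGDrazinInverse (m * g) y) : u * g = y := by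
  have hgm : g * (m * g) = m * g := by rw [← mul_assoc, ← hm]
  have hgy : g * y = y := hy.idem_mul hgm
  have hyg : y * g = y := hy.mul_idem (by rw [mul_assoc, hg.eq])
  have hpow := pow_mul_idem hg hgm
  have hc : g * (1 - m * g * y) = (1 - m * g * y) * g := by
    rw [mul_sub, sub_mul, ← mul_assoc g (m * g), hgm, mul_assoc _ y, hyg, mul_one, one_mul]
  have h1 : u * (g * (1 - m * g * y)) = 0 := by
    refine (hy.geomSmall.mul_right g).eq_zero_of_pow_mul (x := u) fun n => ?_
    calc u * (g * (1 - m * g * y)) = u ^ (n + 1) * m ^ n * (g * (1 - m * g * y)) := by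
          rw [h.pow_mul_pow']
      _ = u ^ (n + 1) * (m ^ n * g * (1 - m * g * y)) := by simp only [mul_assoc]
      _ = u ^ (n + 1) * ((m * g) ^ n * (1 - m * g * y) * g) := by
          rw [hpow, mul_assoc _ g, hc, mul_assoc _ _ g]
  have h2 : (1 - m * u) * y = 0 := by
    refine h.geomSmall'.eq_zero_of_mul_pow (x := y) fun n => ?_
    conv_lhs => rw [← hy.pow_mul_pow n]
    have : y ^ (n + 1) = g * y ^ (n + 1) := by rw [pow_succ', ← mul_assoc, hgy]
    rw [this, ← mul_assoc _ g, ← hpow, mul_assoc _ g, ← this, mul_assoc]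
  rw [mul_sub, mul_one, mul_sub, sub_eq_zero] at h1
  rw [sub_mul, one_mul, sub_eq_zero] at h2
  rw [h1, ← mul_assoc g (m * g), hgm, mul_assoc m, hgy, ← mul_assoc, ← h.comm, ← h2]

theorem mul_eq_of_corestrict {m u y : A} (hg : IsIdempotentElem g) (hm : g * m = g * m * g)
    (h : IsGDrazinInverse m u) (hy : IsGDrazinInverse (g * m) y) : g * u = y := by
  have hgm : g * m * g = g * m := hm.symm
  have hyg : y * g = y := hy.mul_idem hgm
  have hgy : g * y = y := hy.idem_mul (by rw [← mul_assoc, hg.eq])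
  have hpow : ∀ n, g * m ^ n = g * (g * m) ^ n := fun n => by
    induction n with
    | zero => simp
    | succ n ih => 
      rw [pow_succ', ← mul_assoc]
      conv_lhs => rw [← hgm, mul_assoc, ih, ← mul_assoc, hgm]
      rw [pow_succ', ← mul_assoc, ← mul_assoc, hg.eq]
  have hc : (1 - g * m * y) * g = g * (1 - g * m * y) := by
    rw [mul_sub, sub_mul, ← mul_assoc g, ← mul_assoc g, hg.eq, mul_assoc _ y, hyg, mul_one, one_mul]
  have h1 : (1 - g * m * y) * g * u = 0 := by
    refine (hy.geomSmall'.mul_left g).eq_zero_of_mul_pow (x := u) fun n => ?_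
    calc (1 - g * m * y) * g * u = (1 - g * m * y) * g * (m ^ n * u ^ (n + 1)) := by
          rw [h.pow_mul_pow]
      _ = (1 - g * m * y) * (g * m ^ n) * u ^ (n + 1) := by simp only [mul_assoc]
      _ = g * ((1 - g * m * y) * (g * m) ^ n) * u ^ (n + 1) := by
          rw [hpow, ← mul_assoc _ g, hc, ← mul_assoc g]
  have h2 : y * (1 - m * u) = 0 := by
    refine h.geomSmall.eq_zero_of_pow_mul (x := y) fun n => ?_
    conv_lhs => rw [← hy.pow_mul_pow' n]
    have : y ^ (n + 1) = y ^ (n + 1) * g := by rw [pow_succ, mul_assoc, hyg]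
    rw [this, mul_assoc _ g, ← hpow, ← mul_assoc _ g, ← this, mul_assoc]
  rw [sub_mul, sub_mul, one_mul, sub_eq_zero] at h1
  rw [mul_sub, mul_one, sub_eq_zero] at h2
  rw [h1, hy.comm, mul_assoc y, hgm, ← mul_assoc y, hyg, mul_assoc, ← h2]

end IsGDrazinInverse

variable [CompleteSpace A]

/-- The off-diagonal entry of the generalized Drazin inverse of a triangular element with diagonal
entries `x`, `y` and off-diagonal entry `z`, where `x'`, `y'` invert `x`, `y`. -/
noncomputable def offDiag (x x' y y' z : A) : A :=
  ∑' n : ℕ, y' ^ (n + 2) * z * (x ^ n * (1 - x * x'))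
    + ∑' n : ℕ, (1 - y * y') * y ^ n * z * x' ^ (n + 2) - y' * z * x'

section offDiag

variable {x x' y y' z : A}

theorem summable_offDiag_left (hx : IsGDrazinInverse x x') (y' z : A) :
    Summable (fun n : ℕ => y' ^ (n + 2) * z * (x ^ n * (1 - x * x'))) := by
  have := ((hx.geomSmall.mul_left (y' * z)).summable_pow_mul_norm y').of_norm
  refine this.congr fun n => ?_
  rw [pow_succ y' (n + 1)]; simp only [mul_assoc]

theorem summable_offDiag_right (hy : IsGDrazinInverse y y') (x' z : A) :
    Summable (fun n : ℕ => (1 - y * y') * y ^ n * z * x' ^ (n + 2)) := by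
  have := ((hy.geomSmall'.mul_right (z * x')).summable_mul_pow_norm x').of_norm
  refine this.congr fun n => ?_
  rw [pow_succ' x' (n + 1)]; simp only [mul_assoc]

/-- The off-diagonal part of commutation between the element and its inverse. Multiplying by `y` or
`x` shifts the index in each series, leaving only boundary terms. -/
theorem mul_offDiag_add (hx : IsGDrazinInverse x x') (hy : IsGDrazinInverse y y') (z : A) :
    y * offDiag x x' y y' z + z * x' = offDiag x x' y y' z * x + y' * z := by
  have hU := summable_offDiag_left hx y' z
  have hV := summable_offDiag_right hy x' z
  have e1 : y * ∑' n : ℕ, y' ^ (n + 2) * z * (x ^ n * (1 - x * x')) =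
      y' * z * (1 - x * x') + (∑' n : ℕ, y' ^ (n + 2) * z * (x ^ n * (1 - x * x'))) * x := by
    rw [← hU.tsum_mul_left, ← hU.tsum_mul_right, (hU.mul_left y).tsum_eq_zero_add]
    congr 1
    · rw [pow_zero, one_mul, ← mul_assoc, ← mul_assoc, hy.mul_pow_succ]; simp
    · refine tsum_congr fun n => ?_
      rw [← mul_assoc, ← mul_assoc y, hy.mul_pow_succ, mul_assoc _ _ x, mul_assoc _ _ x,
        ← hx.commute_one_sub.eq, ← mul_assoc (x ^ n), pow_succ x]
  have e2 : (∑' n : ℕ, (1 - y * y') * y ^ n * z * x' ^ (n + 2)) * x =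
      (1 - y * y') * z * x' + y * ∑' n : ℕ, (1 - y * y') * y ^ n * z * x' ^ (n + 2) := by
    rw [← hV.tsum_mul_left, ← hV.tsum_mul_right, (hV.mul_right x).tsum_eq_zero_add]
    congr 1
    · rw [mul_assoc, hx.pow_succ_mul]; simp
    · refine tsum_congr fun n => ?_
      rw [mul_assoc, hx.pow_succ_mul, ← mul_assoc, ← mul_assoc, ← mul_assoc,
        hy.commute_one_sub.eq, mul_assoc _ y, pow_succ']
  unfold offDiag
  rw [mul_sub, mul_add, sub_mul, add_mul, e1, e2]
  have c1 := hx.comm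
  linear_combination (norm := noncomm_ring) - y' * z * c1

/-- The off-diagonal part of the outer inverse identity: each series is fixed by one of the
projections `x * x'`, `y' * y` and killed by the other. -/
theorem offDiag_outer (hx : IsGDrazinInverse x x') (hy : IsGDrazinInverse y y') (z : A) :
    offDiag x x' y y' z * (x * x') + y' * z * x' + y' * y * offDiag x x' y y' z =
      offDiag x x' y y' z := by
  have hU := summable_offDiag_left hx y' z
  have hV := summable_offDiag_right hy x' z
  have hxx : (1 - x * x') * (x * x') = 0 := by
    rw [sub_mul, one_mul, mul_assoc, hx.outer', sub_self]
  have hyy : y' * y * (1 - y * y') = 0 := by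
    rw [← hy.comm, mul_sub, mul_one, mul_assoc, hy.outer', sub_self]
  have e1 : (∑' n : ℕ, y' ^ (n + 2) * z * (x ^ n * (1 - x * x'))) * (x * x') = 0 := by
    rw [← hU.tsum_mul_right]
    simp only [mul_assoc _ _ (x * x'), hxx, mul_zero, tsum_zero]
  have e2 : y' * y * (∑' n : ℕ, y' ^ (n + 2) * z * (x ^ n * (1 - x * x'))) =
      ∑' n : ℕ, y' ^ (n + 2) * z * (x ^ n * (1 - x * x')) := by
    rw [← hU.tsum_mul_left]
    refine tsum_congr fun n => ?_
    rw [← mul_assoc, ← mul_assoc (y' * y), mul_assoc y' y, hy.mul_pow_succ, ← pow_succ']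
  have e3 : (∑' n : ℕ, (1 - y * y') * y ^ n * z * x' ^ (n + 2)) * (x * x') =
      ∑' n : ℕ, (1 - y * y') * y ^ n * z * x' ^ (n + 2) := by
    rw [← hV.tsum_mul_right]
    refine tsum_congr fun n => ?_
    rw [mul_assoc, ← mul_assoc _ x, hx.pow_succ_mul, ← pow_succ]
  have e4 : y' * y * (∑' n : ℕ, (1 - y * y') * y ^ n * z * x' ^ (n + 2)) = 0 := by
    rw [← hV.tsum_mul_left]
    simp only [← mul_assoc, hyy, zero_mul, tsum_zero]
  unfold offDiag
  rw [sub_mul, add_mul, mul_sub, mul_add, e1, e2, e3, e4, mul_assoc (y' * z), hx.outer',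
    ← mul_assoc (y' * y), ← mul_assoc (y' * y), hy.outer]
  abel

theorem mul_offDiag_eq_zero (hx : IsGDrazinInverse x x') (hy : IsGDrazinInverse y y') {p : A}
    (hpy : p * y = 0) (hpz : p * z = 0) : p * offDiag x x' y y' z = 0 := by
  have hpy' : p * y' = 0 := by rw [← hy.mul_mul_self, ← mul_assoc, hpy, zero_mul]
  have hU := summable_offDiag_left hx y' z
  have hV := summable_offDiag_right hy x' z
  have h1 : ∀ n : ℕ, p * (y' ^ (n + 2) * z * (x ^ n * (1 - x * x'))) = 0 := fun n => by
    rw [pow_succ' y']; simp only [← mul_assoc, hpy', zero_mul]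
  have h2 : ∀ n : ℕ, p * ((1 - y * y') * y ^ n * z * x' ^ (n + 2)) = 0 := fun n => by
    have : p * (1 - y * y') = p := by rw [mul_sub, ← mul_assoc, hpy]; simp
    simp only [← mul_assoc, this]
    cases n with
    | zero => simp [hpz]
    | succ n => rw [pow_succ' y]; simp only [← mul_assoc, hpy, zero_mul]
  unfold offDiag
  rw [mul_sub, mul_add, ← hU.tsum_mul_left, ← hV.tsum_mul_left]
  simp only [h1, h2, tsum_zero]
  simp only [← mul_assoc, hpy', zero_mul, sub_zero, add_zero]

theorem offDiag_mul_eq_zero (hx : IsGDrazinInverse x x') (hy : IsGDrazinInverse y y') {q : A}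
    (hxq : x * q = 0) (hzq : z * q = 0) : offDiag x x' y y' z * q = 0 := by
  have hxq' : x' * q = 0 := by rw [← hx.self_mul_mul, mul_assoc, mul_assoc, hxq]; simp
  have hU := summable_offDiag_left hx y' z
  have hV := summable_offDiag_right hy x' z
  have h1 : ∀ n : ℕ, y' ^ (n + 2) * z * (x ^ n * (1 - x * x')) * q = 0 := fun n => by
    have : (1 - x * x') * q = q := by rw [sub_mul, mul_assoc, hxq']; simp
    simp only [mul_assoc, this]
    cases n with
    | zero => simp [hzq]
    | succ n => rw [pow_succ x]; simp only [mul_assoc, hxq, mul_zero]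
  have h2 : ∀ n : ℕ, (1 - y * y') * y ^ n * z * x' ^ (n + 2) * q = 0 := fun n => by
    rw [pow_succ x']; simp only [mul_assoc, hxq', mul_zero]
  unfold offDiag
  rw [sub_mul, add_mul, ← hU.tsum_mul_right, ← hV.tsum_mul_right]
  simp only [h1, h2, tsum_zero]
  simp only [mul_assoc, hxq', mul_zero, sub_zero, add_zero]

end offDiag

/-- Split `t = t * p + t * (1 - p)`: the product in this order is zero, and `t * p` is
quasinilpotent because `p * t` is. -/
theorem isQuasinilpotent_of_triangular {p t : A} (ht : p * t = p * t * p)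
    (h1 : IsQuasinilpotent (p * t)) (h2 : IsQuasinilpotent (t * (1 - p))) :
    IsQuasinilpotent t := by
  have h := h1.mul_swap.add_of_mul_eq_zero h2 (by
    rw [show t * p * (t * (1 - p)) = t * (p * t - p * t * p) by noncomm_ring, ← ht, sub_self,
      mul_zero])
  rwa [← mul_add, add_sub_cancel, mul_one] at h

/-- The generalized Drazin inverse of a triangular element. -/
theorem isGDrazinInverse_of_triangular {p m x' y' : A} (hp : IsIdempotentElem p)
    (hm : p * m = p * m * p) (hx : IsGDrazinInverse (p * m) x')
    (hy : IsGDrazinInverse (m * (1 - p)) y') :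
    IsGDrazinInverse m
      (x' + y' + offDiag (p * m) x' (m * (1 - p)) y' ((1 - p) * m * p)) := by
  set q := 1 - p with hq
  set x := p * m with hxd
  set y := m * q with hyd
  set z := q * m * p with hzd
  set s := offDiag x x' y y' z with hs
  have hpq : p * q = 0 := by rw [hq, mul_sub, mul_one, hp.eq, sub_self]
  have hqp : q * p = 0 := by rw [hq, sub_mul, one_mul, hp.eq, sub_self]
  have hpx : p * x = x := by rw [hxd, ← mul_assoc, hp.eq]
  have hxp : x * p = x := hm.symm
  have hxq : x * q = 0 := by rw [← hxp, mul_assoc, hpq, mul_zero]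
  have hpy : p * y = 0 := by rw [hyd, ← mul_assoc, ← hxd, hxq]
  have hyp : y * p = 0 := by rw [hyd, mul_assoc, hqp, mul_zero]
  have hpz : p * z = 0 := by rw [hzd, ← mul_assoc, ← mul_assoc, hpq]; simp
  have hzq : z * q = 0 := by rw [hzd, mul_assoc, hpq, mul_zero]
  have hpx' : p * x' = x' := hx.idem_mul hpx
  have hxp' : x' * p = x' := hx.mul_idem hxp
  have hps : p * s = 0 := mul_offDiag_eq_zero hx hy hpy hpz
  have hsq : s * q = 0 := offDiag_mul_eq_zero hx hy hxq hzq
  have hpy' : p * y' = 0 := by rw [← hy.mul_mul_self, ← mul_assoc, hpy, zero_mul]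
  have hyp' : y' * p = 0 := by rw [← hy.self_mul_mul, mul_assoc, mul_assoc, hyp]; simp
  have hxq' : x' * q = 0 := by rw [← hxp', mul_assoc, hpq, mul_zero]
  -- Triangularity: the component `p * m * q` is absent.
  have hsum : x + y + z = m := by
    have hm' := hxp.symm
    rw [hxd] at hm'
    rw [hxd, hyd, hzd, hq]
    linear_combination (norm := noncomm_ring) hm'
  have hqy : q * y = y := by rw [hq, sub_mul, one_mul, hpy, sub_zero]
  have hqz : q * z = z := by rw [hq, sub_mul, one_mul, hpz, sub_zero]
  have hzp : z * p = z := by rw [hzd, mul_assoc, hp.eq]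
  have hyq' : y' * q = y' := by rw [hq, mul_sub, mul_one, hyp', sub_zero]
  have hxy' : x * y' = 0 := by rw [← hxp, mul_assoc, hpy', mul_zero]
  have hxs : x * s = 0 := by rw [← hxp, mul_assoc, hps, mul_zero]
  have hyx' : y * x' = 0 := by rw [← hpx', ← mul_assoc, hyp, zero_mul]
  have hzy' : z * y' = 0 := by rw [← hzp, mul_assoc, hpy', mul_zero]
  have hzs : z * s = 0 := by rw [← hzp, mul_assoc, hps, mul_zero]
  have hx'y : x' * y = 0 := by rw [← hxp', mul_assoc, hpy, mul_zero]
  have hx'z : x' * z = 0 := by rw [← hxp', mul_assoc, hpz, mul_zero]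
  have hy'x : y' * x = 0 := by rw [← hpx, ← mul_assoc, hyp', zero_mul]
  have hsy : s * y = 0 := by rw [← hqy, ← mul_assoc, hsq, zero_mul]
  have hsz : s * z = 0 := by rw [← hqz, ← mul_assoc, hsq, zero_mul]
  have hmn : m * (x' + y' + s) = x * x' + y * y' + (y * s + z * x') := by
    rw [← hsum]
    simp only [mul_add, add_mul, hxy', hxs, hyx', hzy', hzs]
    abel
  have hnm : (x' + y' + s) * m = x' * x + y' * y + (s * x + y' * z) := by
    rw [← hsum]
    simp only [mul_add, add_mul, hx'y, hx'z, hy'x, hsy, hsz]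
    abel
  have hpn : x * (x' + y' + s) = x * x' := by rw [mul_add, mul_add, hxy', hxs]; simp
  have hnq : (x' + y' + s) * q = y' := by rw [add_mul, add_mul, hxq', hyq', hsq]; simp
  refine ⟨?_, ?_, ?_⟩
  · rw [hnm]
    have ho := offDiag_outer hx hy z
    rw [← hs] at ho
    simp only [mul_add, add_mul, mul_assoc, hxy', hxs, hyx', hzy', hzs, mul_zero, hx.outer',
      hy.outer'] at ho ⊢
    conv_rhs => rw [← ho]
    abel
  · rw [hmn, hnm, hx.comm, hy.comm, mul_offDiag_add hx hy z]
  · set n := x' + y' + s with hn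
    have h1 : p * (m - m ^ 2 * n) = x - x ^ 2 * x' := by
      have : p * (m - m ^ 2 * n) = p * m - p * m * (m * n) := by noncomm_ring
      have hxm : x * m = x * x := by
        conv_lhs => rw [← hxp, mul_assoc, ← hxd]
      rw [this, ← hxd, ← mul_assoc, hxm, mul_assoc x, hpn, pow_two, mul_assoc x]
    have h2 : (m - m ^ 2 * n) * q = y - y ^ 2 * y' := by
      have hqy' : q * y' = y' := by rw [hq, sub_mul, one_mul, hpy', sub_zero]
      have e : (m - m ^ 2 * n) * q = m * q - m * (m * (n * q)) := by noncomm_ring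
      have hmy' : m * y' = y * y' := by
        conv_lhs => rw [← hqy', ← mul_assoc, ← hyd]
      have hmy : m * y = y * y := by
        conv_lhs => rw [← hqy, ← mul_assoc, ← hyd]
      rw [e, hnq, hmy', ← mul_assoc, hmy, ← hyd, pow_two]
    refine isQuasinilpotent_of_triangular (p := p) ?_ ?_ ?_
    · rw [h1, sub_mul, hxp, mul_assoc, hxp']
    · rw [h1]; exact hx.qnil
    · rw [← hq, h2]; exact hy.qnil

end Triangular

/-! ### Perturbation by a quasinilpotent element. -/

section QuasinilpotentPerturbation

variable {A : Type*} [NormedRing A] [NormedAlgebra ℂ A]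

/-- The relation `a b = bᵖ b a bᵖ` for the spectral idempotent `bᵖ = 1 - b x`, where `x` is the
generalized Drazin inverse of `b` and `a` is quasinilpotent. -/
structure QnilPerturbation (a b x : A) : Prop where
  qnil : IsQuasinilpotent a
  inv : IsGDrazinInverse b x
  rel : a * b = (1 - b * x) * b * a * (1 - b * x)

namespace QnilPerturbation

variable {a b x : A}

theorem mul_inv (h : QnilPerturbation a b x) : a * x = 0 := by
  rw [← h.inv.mul_mul_self, ← mul_assoc, h.rel, ← mul_assoc, mul_assoc _ (1 - b * x),
    h.inv.one_sub_mul]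
  simp

theorem mul_one_sub (h : QnilPerturbation a b x) : a * (1 - b * x) = a := by
  rw [h.inv.comm, mul_sub, ← mul_assoc, h.mul_inv]; simp

theorem mul_eq (h : QnilPerturbation a b x) : a * b = (1 - b * x) * b * a := by
  rw [h.rel, mul_assoc _ a, h.mul_one_sub]

theorem inv_mul_mul (h : QnilPerturbation a b x) : x * (a * b) = 0 := by
  rw [h.mul_eq, ← mul_assoc, ← mul_assoc, h.inv.mul_one_sub]; simp

theorem inv_mul_pow_mul (h : QnilPerturbation a b x) (n : ℕ) : x * (a ^ (n + 1) * b) = 0 := by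
  -- Since `a` absorbs `1 - b * x` on its right, `b` can be moved left past all but one factor `a`.
  have hp : ∀ n, a ^ (n + 1) * b = a * b * a ^ n := fun n => by
    induction n with
    | zero => simp
    | succ n ih =>
      have e : a ^ (n + 1) = a ^ (n + 1) * (1 - b * x) := by
        rw [pow_succ, mul_assoc, h.mul_one_sub]
      calc a ^ (n + 1 + 1) * b = a ^ (n + 1) * (1 - b * x) * b * a := by
            rw [pow_succ a (n + 1), mul_assoc, h.mul_eq]; simp only [mul_assoc]
        _ = a * b * a ^ (n + 1) := by rw [← e, ih, mul_assoc, ← pow_succ]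
  rw [hp, ← mul_assoc, h.inv_mul_mul, zero_mul]

theorem one_sub_mul_pow (h : QnilPerturbation a b x) (n : ℕ) :
    (1 - b * x) * (a + b) ^ n = ((1 - b * x) * (a + b)) ^ n * (1 - b * x) := by
  have hf := h.inv.isIdempotentElem_one_sub.eq
  have e : (1 - b * x) * (a + b) = (1 - b * x) * (a + b) * (1 - b * x) := by
    rw [mul_assoc, add_mul, h.mul_one_sub, h.inv.commute_one_sub.eq, mul_add, mul_add,
      ← mul_assoc _ _ b, hf]
  induction n with
  | zero => simp
  | succ n ih => rw [pow_succ, ← mul_assoc, ih, mul_assoc, e, ← mul_assoc, ← e, ← pow_succ]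

variable [CompleteSpace A]

/-- `(1 - b * x) * a` and `(1 - b * x) * b` are quasinilpotent and commute by the defining relation.
-/
theorem qnil_one_sub_mul (h : QnilPerturbation a b x) :
    IsQuasinilpotent ((1 - b * x) * (a + b)) := by
  have h1 : IsQuasinilpotent ((1 - b * x) * a) :=
    IsQuasinilpotent.mul_swap (by rw [h.mul_one_sub]; exact h.qnil)
  have e : (1 - b * x) * b = b - b ^ 2 * x := by
    rw [← h.inv.commute_one_sub.eq]; noncomm_ring
  have h2 : IsQuasinilpotent ((1 - b * x) * b) := by rw [e]; exact h.inv.qnil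
  rw [mul_add]
  refine h1.add_of_commute h2 ?_
  have hf := h.inv.isIdempotentElem_one_sub.eq
  have hcf := h.inv.commute_one_sub.eq
  have hr : (1 - b * x) * (a * b) = a * b := by
    rw [h.mul_eq]; simp only [← mul_assoc, hf]
  rw [Commute, SemiconjBy, ← mul_assoc, mul_assoc _ a, h.mul_one_sub, mul_assoc, hr, ← hcf,
    mul_assoc, ← mul_assoc (1 - b * x), hf, ← mul_assoc, hcf, h.mul_eq]

theorem geomSmall_one_sub_mul_pow (h : QnilPerturbation a b x) :
    GeomSmall (fun n => (1 - b * x) * (a + b) ^ n) := by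
  simp only [h.one_sub_mul_pow]
  exact h.qnil_one_sub_mul.geomSmall.mul_right _

theorem geomSmall_mul_pow (h : QnilPerturbation a b x) :
    GeomSmall (fun n => a * (a + b) ^ n) := by
  have := h.geomSmall_one_sub_mul_pow.mul_left a
  simpa only [← mul_assoc, h.mul_one_sub] using this

theorem summable_norm (h : QnilPerturbation a b x) :
    Summable (fun n : ℕ => ‖x ^ (n + 1) * a ^ n‖) :=
  h.qnil.geomSmall.summable_pow_mul_norm x

theorem summable_norm_succ (h : QnilPerturbation a b x) :
    Summable (fun n : ℕ => ‖x ^ (n + 1) * a ^ (n + 1)‖) :=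
  h.qnil.geomSmall.shift.summable_pow_mul_norm x

theorem mul_tsum (h : QnilPerturbation a b x) :
    a * ∑' n : ℕ, x ^ (n + 1) * a ^ n = 0 := by
  rw [← h.summable_norm.of_norm.tsum_mul_left]
  simp only [pow_succ' x, ← mul_assoc, h.mul_inv, zero_mul, tsum_zero]

theorem add_mul_tsum (h : QnilPerturbation a b x) :
    (a + b) * ∑' n : ℕ, x ^ (n + 1) * a ^ n =
      b * x + ∑' n : ℕ, x ^ (n + 1) * a ^ (n + 1) := by
  have hs := h.summable_norm.of_norm
  rw [add_mul, h.mul_tsum, zero_add, ← hs.tsum_mul_left, (hs.mul_left b).tsum_eq_zero_add]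
  congr 1
  · simp
  · refine tsum_congr fun n => ?_
    rw [← mul_assoc, h.inv.mul_pow_succ]

theorem tsum_mul_self (h : QnilPerturbation a b x) :
    (∑' n : ℕ, x ^ (n + 1) * a ^ n) * b = x * b := by
  have hs := h.summable_norm.of_norm
  rw [← hs.tsum_mul_right, (hs.mul_right b).tsum_eq_zero_add]
  have : ∀ n : ℕ, x ^ (n + 1 + 1) * a ^ (n + 1) * b = 0 := fun n => by
    rw [pow_succ x, mul_assoc, mul_assoc, h.inv_mul_pow_mul, mul_zero]
  simp [this]

theorem inv_mul_self_mul_tsum (h : QnilPerturbation a b x) :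
    x * b * ∑' n : ℕ, x ^ (n + 1) * a ^ n = ∑' n : ℕ, x ^ (n + 1) * a ^ n := by
  rw [← h.summable_norm.of_norm.tsum_mul_left]
  refine tsum_congr fun n => ?_
  rw [pow_succ' x, ← mul_assoc, ← mul_assoc, h.inv.outer]

/-- The sum `t` satisfies `t * b = x * b` and `t = x * b * t`, whence `t * t = x * t`. -/
theorem tsum_pow (h : QnilPerturbation a b x) (n : ℕ) :
    (∑' k : ℕ, x ^ (k + 1) * a ^ k) ^ (n + 1) = x ^ n * ∑' k : ℕ, x ^ (k + 1) * a ^ k := by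
  set t := ∑' k : ℕ, x ^ (k + 1) * a ^ k with ht
  have htt : t * t = x * t := by
    have h1 := h.tsum_mul_self
    have h2 := h.inv_mul_self_mul_tsum
    rw [← ht] at h1 h2
    calc t * t = t * (x * b * t) := by rw [h2]
      _ = t * b * x * t := by rw [← h.inv.comm]; simp only [mul_assoc]
      _ = x * t := by rw [h1, h.inv.outer]
  induction n with
  | zero => simp
  | succ n ih => rw [pow_succ, ih, mul_assoc, htt, ← mul_assoc, ← pow_succ]

theorem isGDrazinInverse_add (h : QnilPerturbation a b x) :
    IsGDrazinInverse (a + b) (∑' n : ℕ, x ^ (n + 1) * a ^ n) := by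
  have h1 := h.add_mul_tsum
  have h2 := h.tsum_mul_self
  have h3 := h.inv_mul_self_mul_tsum
  have h4 := h.mul_tsum
  have hs := h.summable_norm.of_norm
  have hr : (∑' n : ℕ, x ^ (n + 1) * a ^ n) * a = ∑' n : ℕ, x ^ (n + 1) * a ^ (n + 1) := by
    rw [← hs.tsum_mul_right]
    exact tsum_congr fun n => by rw [mul_assoc, ← pow_succ]
  set t := ∑' n : ℕ, x ^ (n + 1) * a ^ n with ht
  have hc : (a + b) * t = t * (a + b) := by
    rw [h1, mul_add, hr, h2, h.inv.comm, add_comm]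
  have ho : t * (a + b) * t = t := by
    rw [mul_add, add_mul, mul_assoc t a, h4, h2, h3, mul_zero, zero_add]
  -- The complement of `(a + b) * t` lies under `1 - b * x`, so the quasinilpotent part of `a + b`
  -- is cut out of `(1 - b * x) * (a + b)`.
  have hπf : (1 - (a + b) * t) * (1 - b * x) = 1 - (a + b) * t := by
    have e1 : a * (b * x) = 0 := by rw [h.inv.comm, ← mul_assoc, h.mul_inv, zero_mul]
    have e2 : t * (b * (b * x)) = b * x := by
      rw [← mul_assoc, h2, ← h.inv.comm, mul_assoc, h.inv.outer']
    rw [hc, mul_sub, mul_one, sub_eq_self, sub_mul, one_mul, mul_assoc, add_mul, e1, zero_add,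
      e2, sub_self]
  set y := a + b with hy
  have e : y - y ^ 2 * t = (1 - y * t) * ((1 - b * x) * y) := by
    rw [← mul_assoc, hπf, sub_mul, one_mul, pow_two, mul_assoc, mul_assoc, ← hc]
  refine ⟨ho, hc, ?_⟩
  rw [e]
  refine h.qnil_one_sub_mul.idem_mul ?_
  have hz : (y - y ^ 2 * t) * (y * t) = 0 := by
    rw [sub_mul, pow_two, mul_assoc (y * y), mul_assoc, ← mul_assoc t, ho, sub_self]
  rw [← e, mul_sub, mul_one, hz, sub_zero]

end QnilPerturbation

end QuasinilpotentPerturbation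

/-! ### The additive formula for a triangular pair. -/

section AdditiveFormula

variable {A : Type*} [NormedRing A] [NormedAlgebra ℂ A]

theorem idem_mul_pow_mul {R : Type*} [Monoid R] {q m : R} (hq : IsIdempotentElem q)
    (h : q * (m * q) = m * q) (n : ℕ) :
    q * (m ^ n * q) = m ^ n * q := by
  induction n with
  | zero => simp [hq.eq]
  | succ n ih =>
    rw [pow_succ', mul_assoc, ← ih, ← mul_assoc m, ← mul_assoc, h]

theorem pow_succ_mul_idem {R : Type*} [Monoid R] {q m : R} (hq : IsIdempotentElem q)
    (h : q * (m * q) = m * q) (n : ℕ) :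
    m ^ (n + 1) * q = (m * q) ^ (n + 1) := by
  rw [pow_mul_idem hq h, pow_succ, mul_assoc, mul_assoc m, hq.eq]

/-- Two elements `a`, `b` that are triangular with respect to the idempotents `p` and `q = 1 - p`,
with `a` diagonal, such that `a q` perturbs `b q` quasinilpotently; `b'` and `c'` are the
generalized Drazin inverses of `b` and of `p (a + b)`. -/
structure TriangularSum (a b p q b' c' : A) : Prop where
  idem : IsIdempotentElem p
  compl : q = 1 - p
  comm : Commute a p
  invariant : q * (b * q) = b * q
  inv_invariant : q * (b' * q) = b' * q
  perturb : QnilPerturbation (a * q) (b * q) (b' * q)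
  corner : IsGDrazinInverse (p * (a + b)) c'

namespace TriangularSum

variable {a b p q b' c' : A}

theorem idem_compl (h : TriangularSum a b p q b' c') : IsIdempotentElem q := by
  rw [h.compl]; exact h.idem.one_sub

theorem comm_compl (h : TriangularSum a b p q b' c') : Commute a q := by
  rw [h.compl]; exact (Commute.one_right a).sub_right h.comm

theorem mul_compl (h : TriangularSum a b p q b' c') : p * q = 0 := by
  rw [h.compl, mul_sub, mul_one, h.idem.eq, sub_self]

theorem compl_mul (h : TriangularSum a b p q b' c') : q * p = 0 := by
  rw [h.compl, sub_mul, one_mul, h.idem.eq, sub_self]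

theorem diag_invariant (h : TriangularSum a b p q b' c') : q * (a * q) = a * q := by
  rw [← mul_assoc, ← h.comm_compl.eq, mul_assoc, h.idem_compl.eq]

theorem add_invariant (h : TriangularSum a b p q b' c') : q * ((a + b) * q) = (a + b) * q := by
  rw [add_mul, mul_add, h.diag_invariant, h.invariant]

theorem corner_invariant (h : TriangularSum a b p q b' c') :
    p * (a + b) = p * (a + b) * p := by
  have e : p * ((a + b) * q) = 0 := by
    rw [← h.add_invariant, ← mul_assoc, h.mul_compl, zero_mul]
  rw [h.compl, mul_sub, mul_one, mul_sub, sub_eq_zero] at e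
  rw [mul_assoc, ← e]

theorem idem_mul_corner_inv (h : TriangularSum a b p q b' c') : p * c' = c' :=
  h.corner.idem_mul (by rw [← mul_assoc, h.idem.eq])

/-- The leading `q` is what makes exponent zero correct. -/
theorem diag_pow (h : TriangularSum a b p q b' c') (n : ℕ) : q * (a * q) ^ n = a ^ n * q := by
  rw [h.comm_compl.mul_pow, ← mul_assoc, ← (h.comm_compl.pow_left n).eq, mul_assoc]
  rcases n with _ | n
  · simp
  · rw [h.idem_compl.pow_succ_eq, h.idem_compl.eq]

theorem term_eq (h : TriangularSum a b p q b' c') (n k : ℕ) :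
    (b' * q) ^ (n + 1) * (a * q) ^ k = b' ^ (n + 1) * a ^ k * q := by
  rw [← pow_succ_mul_idem h.idem_compl h.inv_invariant, mul_assoc, h.diag_pow, mul_assoc]

theorem one_sub_mul (h : TriangularSum a b p q b' c') (n : ℕ) :
    (1 - b * q * (b' * q)) * ((a + b) * q) ^ n * q = (1 - b * b') * (a + b) ^ n * q := by
  have e : (1 - b * q * (b' * q)) * q = (1 - b * b') * q := by
    rw [mul_assoc b q, h.inv_invariant, sub_mul, sub_mul, mul_assoc b, mul_assoc b', h.idem_compl.eq,
      mul_assoc]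
  have hi := idem_mul_pow_mul h.idem_compl h.add_invariant n
  rw [mul_assoc, ← pow_mul_idem h.idem_compl h.add_invariant, ← hi, ← mul_assoc, e, mul_assoc, hi,
    mul_assoc]

theorem double_term_eq (h : TriangularSum a b p q b' c') (n k : ℕ) :
    (b' * q) ^ (k + 1) * (a * q) ^ (k + 1) * ((a + b) * q) ^ n * (q * b * c' ^ (n + 2)) =
      b' ^ (k + 1) * a ^ (k + 1) * (a + b) ^ n * q * b * c' ^ (n + 2) := by
  have hi := idem_mul_pow_mul h.idem_compl h.add_invariant n
  have hm := pow_mul_idem h.idem_compl h.add_invariant n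
  rw [h.term_eq]
  calc _ = b' ^ (k + 1) * a ^ (k + 1) * (q * (((a + b) * q) ^ n * q)) * b * c' ^ (n + 2) := by
        simp only [mul_assoc]
    _ = _ := by rw [← hm, hi]; simp only [mul_assoc]

variable [CompleteSpace A]

theorem summable_norm (h : TriangularSum a b p q b' c') :
    Summable (fun n : ℕ => ‖b' ^ (n + 1) * a ^ n * q‖) := by
  simpa only [h.term_eq] using h.perturb.summable_norm

theorem isGDrazinInverse_compl (h : TriangularSum a b p q b' c') :
    IsGDrazinInverse ((a + b) * q) (∑' n : ℕ, b' ^ (n + 1) * a ^ n * q) := by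
  have := h.perturb.isGDrazinInverse_add
  simpa only [h.term_eq, ← add_mul] using this

theorem tsum_mul_compl (h : TriangularSum a b p q b' c') :
    (∑' n : ℕ, b' ^ (n + 1) * a ^ n * q) * q = ∑' n : ℕ, b' ^ (n + 1) * a ^ n * q :=
  h.isGDrazinInverse_compl.mul_idem (by rw [mul_assoc, h.idem_compl.eq])

theorem compl_mul_tsum (h : TriangularSum a b p q b' c') :
    q * (∑' n : ℕ, b' ^ (n + 1) * a ^ n * q) = ∑' n : ℕ, b' ^ (n + 1) * a ^ n * q :=
  h.isGDrazinInverse_compl.idem_mul h.add_invariant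

theorem tsum_pow (h : TriangularSum a b p q b' c') (n : ℕ) :
    (∑' k : ℕ, b' ^ (k + 1) * a ^ k * q) ^ (n + 2) =
      b' ^ (n + 1) * ∑' k : ℕ, b' ^ (k + 1) * a ^ k * q := by
  have := h.perturb.tsum_pow (n + 1)
  simp only [h.term_eq] at this
  rw [this, ← pow_succ_mul_idem h.idem_compl h.inv_invariant, mul_assoc, h.compl_mul_tsum]

theorem summable_spec (h : TriangularSum a b p q b' c') :
    Summable (fun n : ℕ => (1 - b * b') * (a + b) ^ n * q * b * c' ^ (n + 2)) := by
  have := ((h.perturb.geomSmall_one_sub_mul_pow.mul_right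
    (q * b * c')).summable_mul_pow_norm c').of_norm
  refine this.congr fun n => ?_
  rw [← h.one_sub_mul, ← add_mul, pow_succ' c' (n + 1)]
  simp only [mul_assoc]

theorem summable_double_corner (h : TriangularSum a b p q b' c') :
    Summable (fun i : ℕ × ℕ => b' ^ (i.1 + i.2 + 2) * a ^ i.2 * q * b * p *
      (p * (a + b)) ^ i.1 * (1 - p * (a + b) * c')) := by
  have h1 : Summable (fun n : ℕ => ‖b'‖ ^ n * ‖(p * (a + b)) ^ n * (1 - p * (a + b) * c')‖) :=
    h.corner.geomSmall.summable (norm_nonneg b')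
  -- Splitting `b' ^ (n + k + 2)` as `b' ^ (n + 1) * b' ^ (k + 1)` gives a majorant that is a
  -- product of two single series.
  have h2 := (h1.mul_left ‖b'‖).mul_of_nonneg (h.summable_norm.mul_right ‖b * p‖)
    (fun n => by positivity) (fun n => by positivity)
  refine Summable.of_norm_bounded h2 fun i => ?_
  have e : b' ^ (i.1 + i.2 + 2) * a ^ i.2 * q * b * p * (p * (a + b)) ^ i.1 *
      (1 - p * (a + b) * c') = b' ^ (i.1 + 1) * (b' ^ (i.2 + 1) * a ^ i.2 * q) * (b * p) *
        ((p * (a + b)) ^ i.1 * (1 - p * (a + b) * c')) := by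
    rw [show i.1 + i.2 + 2 = (i.1 + 1) + (i.2 + 1) by ring, pow_add]
    simp only [mul_assoc]
  rw [e]
  calc _ ≤ ‖b'‖ * ‖b'‖ ^ i.1 * ‖b' ^ (i.2 + 1) * a ^ i.2 * q‖ * ‖b * p‖ *
        ‖(p * (a + b)) ^ i.1 * (1 - p * (a + b) * c')‖ := by
        refine (norm_mul_le _ _).trans (mul_le_mul_of_nonneg_right ?_ (norm_nonneg _))
        refine (norm_mul_le _ _).trans (mul_le_mul_of_nonneg_right ?_ (norm_nonneg _))
        refine (norm_mul_le _ _).trans (mul_le_mul_of_nonneg_right ?_ (norm_nonneg _))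
        exact norm_pow_succ_le b' _
    _ = _ := by ring

theorem summable_double_spec (h : TriangularSum a b p q b' c') :
    Summable (fun i : ℕ × ℕ => b' ^ (i.2 + 1) * a ^ (i.2 + 1) * (a + b) ^ i.1 * q * b *
      c' ^ (i.1 + 2)) := by
  -- One factor of `a ^ (k + 1)` is lent to `(a + b) ^ n`: decay is available for `a * (a + b) ^ n`
  -- on the corner of `q`.
  have h1 := (h.perturb.geomSmall_mul_pow.mul_right (q * b * c')).summable_mul_pow_norm c'
  have h2 := (summable_mul_of_summable_norm h.perturb.summable_norm h1).prod_symm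
  refine h2.congr fun i => ?_
  rw [← h.double_term_eq, ← add_mul, pow_succ' c' (i.1 + 1), pow_succ (a * q)]
  simp only [Prod.fst_swap, Prod.snd_swap, mul_assoc]

/-- The generalized Drazin inverse of the sum. -/
theorem isGDrazinInverse_add (h : TriangularSum a b p q b' c') :
    IsGDrazinInverse (a + b)
      (c' + (∑' n : ℕ, b' ^ (n + 1) * a ^ n * q)
        - (∑' n : ℕ, b' ^ (n + 1) * a ^ n * q * b * c')
        + (∑' n : ℕ, ∑' k : ℕ, b' ^ (n + k + 2) * a ^ k * q * b * p *
            (p * (a + b)) ^ n * (1 - p * (a + b) * c'))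
        + (∑' n : ℕ, (1 - b * b') * (a + b) ^ n * q * b * c' ^ (n + 2))
        - (∑' n : ℕ, ∑' k : ℕ, b' ^ (k + 1) * a ^ (k + 1) * (a + b) ^ n * q * b *
            c' ^ (n + 2))) := by
  have hs := h.summable_norm.of_norm
  have hT := h.isGDrazinInverse_compl
  have hp1 : (1 : A) - p = q := h.compl.symm
  have main := isGDrazinInverse_of_triangular h.idem h.corner_invariant h.corner
    (by rw [hp1]; exact hT)
  rw [hp1] at main
  have hz : q * (a + b) * p = q * b * p := by
    rw [mul_add, ← h.comm_compl.eq, add_mul, mul_assoc, h.compl_mul, mul_zero, zero_add]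
  have e1 : ∑' n : ℕ, b' ^ (n + 1) * a ^ n * q * b * c' =
      (∑' n : ℕ, b' ^ (n + 1) * a ^ n * q) * (q * b * p) * c' := by
    rw [← mul_assoc, ← mul_assoc, h.tsum_mul_compl, mul_assoc _ p, h.idem_mul_corner_inv, mul_assoc,
      ← hs.tsum_mul_right]
    simp only [mul_assoc]
  -- Powers of the corner inverse `T` collapse to `b' ^ (n + 1) * T`.
  have e2 : ∀ n : ℕ, ∑' k : ℕ, b' ^ (n + k + 2) * a ^ k * q * b * p *
      (p * (a + b)) ^ n * (1 - p * (a + b) * c') =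
      (∑' k : ℕ, b' ^ (k + 1) * a ^ k * q) ^ (n + 2) * (q * b * p) *
        ((p * (a + b)) ^ n * (1 - p * (a + b) * c')) := fun n => by
    set w := b * p * ((p * (a + b)) ^ n * (1 - p * (a + b) * c')) with hw
    calc _ = ∑' k : ℕ, b' ^ (n + 1) * (b' ^ (k + 1) * a ^ k * q * w) := by
          refine tsum_congr fun k => ?_
          rw [hw, show n + k + 2 = (n + 1) + (k + 1) by ring, pow_add]
          simp only [mul_assoc]
      _ = b' ^ (n + 1) * ((∑' k : ℕ, b' ^ (k + 1) * a ^ k * q) * w) := by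
          rw [(hs.mul_right w).tsum_mul_left, hs.tsum_mul_right]
      _ = _ := by
          rw [h.tsum_pow]
          conv_lhs => rw [← h.tsum_mul_compl, hw]
          simp only [mul_assoc]
  -- The spectral idempotent of `(a + b) * q` is that of `b * q` minus a series; this produces the
  -- last two sums of the formula.
  have e3 : ∀ n : ℕ, (1 - (a + b) * q * ∑' k : ℕ, b' ^ (k + 1) * a ^ k * q) *
      ((a + b) * q) ^ n * (q * b * p) * c' ^ (n + 2) =
      (1 - b * b') * (a + b) ^ n * q * b * c' ^ (n + 2) -
      ∑' k : ℕ, b' ^ (k + 1) * a ^ (k + 1) * (a + b) ^ n * q * b * c' ^ (n + 2) := fun n => by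
    have hpc : p * c' ^ (n + 2) = c' ^ (n + 2) := by
      rw [pow_succ', ← mul_assoc, h.idem_mul_corner_inv]
    have hy := h.perturb.add_mul_tsum
    simp only [← add_mul] at hy
    have ht : ∑' k : ℕ, (b' * q) ^ (k + 1) * (a * q) ^ k = ∑' k : ℕ, b' ^ (k + 1) * a ^ k * q :=
      tsum_congr fun k => h.term_eq k k
    rw [ht] at hy
    have hz' : q * b * p * c' ^ (n + 2) = q * b * c' ^ (n + 2) := by rw [mul_assoc, hpc]
    rw [hy, ← sub_sub, mul_assoc _ (q * b * p), hz', sub_mul, sub_mul]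
    congr 1
    · rw [← h.one_sub_mul]; simp only [mul_assoc]
    · simp only [← h.double_term_eq]
      rw [mul_assoc, ← h.perturb.summable_norm_succ.of_norm.tsum_mul_right]
      simp only [mul_assoc]
  have e4 : Summable (fun n : ℕ => ∑' k : ℕ, b' ^ (k + 1) * a ^ (k + 1) * (a + b) ^ n * q * b *
      c' ^ (n + 2)) := h.summable_double_spec.prod
  convert main using 1
  unfold offDiag
  rw [hz]
  simp only [e3]
  rw [h.summable_spec.tsum_sub e4, e1]
  simp only [e2]
  abel

end TriangularSum

end AdditiveFormula

/-! ### Transfer between the algebra and its corners. -/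

section Corners

variable {A : Type*} [NormedRing A] [NormedAlgebra ℂ A]

/-- The relation involves `1 - b * b'`, its corner version `1 - b * q * (b' * q)`; the two agree
after multiplication by `q`, and invariance of the range of `q` lets `q` be inserted where needed.
-/
theorem IsGDrazinInverse.qnilPerturbation {a a' b b' : A} (ha : IsGDrazinInverse a a')
    (hbq : (1 - a * a') * (b * (1 - a * a')) = b * (1 - a * a'))
    (hb'q : (1 - a * a') * (b' * (1 - a * a')) = b' * (1 - a * a'))
    (hinv : IsGDrazinInverse (b * (1 - a * a')) (b' * (1 - a * a')))
    (hab : a * b * (1 - a * a') =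
      (1 - a * a') * (1 - b * b') * b * a * (1 - b * b') * (1 - a * a')) :
    QnilPerturbation (a * (1 - a * a')) (b * (1 - a * a')) (b' * (1 - a * a')) := by
  have hq := ha.isIdempotentElem_one_sub.eq
  have hc : a * (1 - a * a') = (1 - a * a') * a := ha.commute_one_sub
  have hqn : IsQuasinilpotent (a * (1 - a * a')) := by
    have e : a * (1 - a * a') = a - a ^ 2 * a' := by noncomm_ring
    rw [e]; exact ha.qnil
  generalize 1 - a * a' = q at *
  refine ⟨hqn, hinv, ?_⟩
  have e0 : b * q * (b' * q) = b * b' * q := by rw [mul_assoc, hb'q, mul_assoc]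
  have e1 : q * (b * b' * q) = b * b' * q := by
    rw [← e0, ← mul_assoc, hbq]
  set f := 1 - b * b' with hf
  have hfq : q * (f * q) = f * q := by
    rw [hf, sub_mul, one_mul, mul_sub, hq, e1]
  have hq1 : (1 - b * b' * q) * q = f * q := by
    rw [hf, sub_mul, sub_mul, mul_assoc _ q, hq]
  have hq2 : q * (1 - b * b' * q) = f * q := by
    rw [hf, sub_mul, mul_sub, mul_one, e1, one_mul]
  have hbr : b * (a * (f * q)) = q * (b * (a * (f * q))) := by
    rw [← hfq, ← mul_assoc a q, hc, mul_assoc q, ← mul_assoc b q, ← mul_assoc q, hbq]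
  rw [e0]
  calc a * q * (b * q) = a * b * q := by rw [mul_assoc, hbq, mul_assoc]
    _ = q * f * b * a * f * q := hab
    _ = q * (f * (b * (a * (f * q)))) := by simp only [mul_assoc]
    _ = f * (b * (a * (f * q))) := by
        rw [hbr, ← mul_assoc f, ← mul_assoc q, hfq]
    _ = (1 - b * b' * q) * (b * (a * (f * q))) := by
        rw [hbr, ← mul_assoc, ← hq1, mul_assoc]
    _ = (1 - b * b' * q) * (b * q) * (a * q) * (1 - b * b' * q) := by
        rw [mul_assoc _ (a * q), mul_assoc a, hq2, mul_assoc _ (b * q), mul_assoc b q,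
          ← mul_assoc q a, ← hc, mul_assoc a q, hfq]

variable [CompleteSpace A]

/-- If the range of the idempotent `1 - p` is invariant under the generalized Drazin invertible
element `m`, then invertibility of the compression to `p` yields that of the restriction to
`1 - p`. -/
theorem IsGDrazinInverse.restrict_of_corestrict {m u p : A} (hp : IsIdempotentElem p)
    (hm : p * m = p * m * p) (h : IsGDrazinInverse m u) (hx : IsGDrazinInvertible (p * m)) :
    IsGDrazinInvertible (m * (1 - p)) := by
  obtain ⟨x, hx⟩ := hx
  have hu : p * u = x := h.mul_eq_of_corestrict hp hm hx
  have hup : p * u * p = p * u := by rw [hu]; exact hx.mul_idem hm.symm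
  refine ⟨_, h.restrict (g := 1 - p) ?_ ?_⟩
  · linear_combination (norm := noncomm_ring) hm
  · linear_combination (norm := noncomm_ring) - hup

/-- Compatibility with the inverse of the restriction shows that `u` preserves the range of `1 - p`,
so `u` passes to the quotient. -/
theorem IsGDrazinInverse.corestrict_of_restrict {m u p : A} (hp : IsIdempotentElem p)
    (hm : p * m = p * m * p) (h : IsGDrazinInverse m u)
    (hy : IsGDrazinInvertible (m * (1 - p))) : IsGDrazinInvertible (p * m) := by
  obtain ⟨y, hy⟩ := hy
  have hm' : m * (1 - p) = (1 - p) * m * (1 - p) := by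
    linear_combination (norm := noncomm_ring) hm
  have hu : u * (1 - p) = y := h.mul_eq_of_restrict hp.one_sub hm' hy
  have hpu : (1 - p) * (u * (1 - p)) = u * (1 - p) := by
    rw [hu]; exact hy.idem_mul (by rw [← mul_assoc, ← hm'])
  refine ⟨_, h.corestrict (g := p) hm ?_⟩
  linear_combination (norm := noncomm_ring) - hpu

theorem IsGDrazinInvertible.mul_swap {u v : A} (h : IsGDrazinInvertible (u * v)) :
    IsGDrazinInvertible (v * u) :=
  let ⟨_, hd⟩ := h
  ⟨_, hd.cline⟩

end Corners

/-! ### The main theorem. -/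

theorem theorem2p1 {A : Type*} [NormedRing A] [NormedAlgebra ℂ A] [CompleteSpace A]
    (a b c : A) (ha : IsGDrazinInvertible a) (hb : IsGDrazinInvertible b)
    (hab : a * b * specIdem a =
      specIdem a * specIdem b * b * a * specIdem b * specIdem a)
    (h : IsGDrazinInvertible (specIdem a * b * specIdem a) ∨
      IsGDrazinInvertible (specIdem a * b) ∨
      IsGDrazinInvertible (b * specIdem a) ∨
      IsGDrazinInvertible (a * gDrazin a * b * (a * gDrazin a)) ∨
      IsGDrazinInvertible (a * gDrazin a * b) ∨
      IsGDrazinInvertible (b * (a * gDrazin a)))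
    (hc : c = a * gDrazin a * (a + b)) :
    (IsGDrazinInvertible (a + b) ↔ IsGDrazinInvertible c) ∧
    (IsGDrazinInvertible c ↔ IsGDrazinInvertible ((a + b) * (a * gDrazin a))) ∧
    (IsGDrazinInvertible ((a + b) * (a * gDrazin a)) ↔
      IsGDrazinInvertible (a * gDrazin a * (a + b) * (a * gDrazin a))) ∧
    (IsGDrazinInvertible (a + b) →
      -- all the series below converge, the double ones jointly in both indices
      Summable (fun n : ℕ => gDrazin b ^ (n + 1) * a ^ n * specIdem a) ∧
      Summable (fun n : ℕ => gDrazin b ^ (n + 1) * a ^ n * specIdem a * b * gDrazin c) ∧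
      Summable (fun q : ℕ × ℕ => gDrazin b ^ (q.1 + q.2 + 2) * a ^ q.2 * specIdem a * b *
        (a * gDrazin a) * c ^ q.1 * specIdem c) ∧
      Summable (fun n : ℕ =>
        specIdem b * (a + b) ^ n * specIdem a * b * gDrazin c ^ (n + 2)) ∧
      Summable (fun q : ℕ × ℕ => gDrazin b ^ (q.2 + 1) * a ^ (q.2 + 1) * (a + b) ^ q.1 *
        specIdem a * b * gDrazin c ^ (q.1 + 2)) ∧
      gDrazin (a + b) =
        gDrazin c
        + (∑' n : ℕ, gDrazin b ^ (n + 1) * a ^ n * specIdem a)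
        - (∑' n : ℕ, gDrazin b ^ (n + 1) * a ^ n * specIdem a * b * gDrazin c)
        + (∑' n : ℕ, ∑' k : ℕ, gDrazin b ^ (n + k + 2) * a ^ k * specIdem a * b *
            (a * gDrazin a) * c ^ n * specIdem c)
        + (∑' n : ℕ, specIdem b * (a + b) ^ n * specIdem a * b * gDrazin c ^ (n + 2))
        - (∑' n : ℕ, ∑' k : ℕ, gDrazin b ^ (k + 1) * a ^ (k + 1) * (a + b) ^ n *
            specIdem a * b * gDrazin c ^ (n + 2))) := by
  have hA := ha.isGDrazinInverse_gDrazin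
  have hB := hb.isGDrazinInverse_gDrazin
  have hpi : IsIdempotentElem (a * gDrazin a) := by
    rw [IsIdempotentElem, mul_assoc, hA.outer']
  have hcp : Commute a (a * gDrazin a) := by
    have hcc : Commute a (gDrazin a) := hA.comm
    exact (Commute.refl a).mul_right hcc
  have hpq : a * gDrazin a * specIdem a = 0 := by
    rw [specIdem, mul_assoc, hA.mul_one_sub, mul_zero]
  have hpbq : a * gDrazin a * b * specIdem a = 0 := by
    -- The right side of `hab` starts with `specIdem a`, which `a * gDrazin a` kills; the extra
    -- `gDrazin a` then cancels `a`.
    have h1 : gDrazin a * (a * gDrazin a * (a * b * specIdem a)) = 0 := by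
      rw [hab]; simp only [← mul_assoc (a * gDrazin a), hpq, zero_mul, mul_zero]
    rw [← h1]
    simp only [← mul_assoc, hA.outer]
    rw [hA.comm]
  have hbp : a * gDrazin a * b = a * gDrazin a * b * (a * gDrazin a) := by
    rw [specIdem, mul_sub, mul_one, sub_eq_zero] at hpbq
    exact hpbq
  have hbq : specIdem a * (b * specIdem a) = b * specIdem a := by
    rw [specIdem, sub_mul, one_mul, sub_eq_self, ← mul_assoc]; exact hpbq
  have hbqi : IsGDrazinInvertible (b * specIdem a) := by
    -- The first three alternatives reduce to `b * specIdem a` directly or by Cline; the last three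
    -- give the compression of `b` to `a * gDrazin a`, and invertibility of `b` transfers it to the
    -- complementary corner.
    rcases h with h | h | h | h | h | h
    · rwa [mul_assoc, hbq] at h
    · exact h.mul_swap
    · exact h
    · rw [← hbp] at h
      exact hB.restrict_of_corestrict hpi hbp h
    · exact hB.restrict_of_corestrict hpi hbp h
    · exact hB.restrict_of_corestrict hpi hbp h.mul_swap
  have hqi : IsIdempotentElem (specIdem a) := hA.isIdempotentElem_one_sub
  have hinv : IsGDrazinInverse (b * specIdem a) (gDrazin b * specIdem a) := by
    rw [hB.mul_eq_of_restrict hqi (by rw [mul_assoc, hbq]) hbqi.isGDrazinInverse_gDrazin]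
    exact hbqi.isGDrazinInverse_gDrazin
  have hb'q : specIdem a * (gDrazin b * specIdem a) = gDrazin b * specIdem a :=
    hinv.idem_mul hbq
  have hQ : QnilPerturbation (a * specIdem a) (b * specIdem a) (gDrazin b * specIdem a) :=
    hA.qnilPerturbation hbq hb'q hinv hab
  have hcm : a * gDrazin a * (a + b) = a * gDrazin a * (a + b) * (a * gDrazin a) := by
    rw [mul_add, add_mul, ← hbp, ← hcp.eq, mul_assoc a (a * gDrazin a), hpi.eq]
  have hT : ∀ {c' : A}, IsGDrazinInverse c c' →
      TriangularSum a b (a * gDrazin a) (specIdem a) (gDrazin b) c' := fun hc' =>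
    ⟨hpi, rfl, hcp, hbq, hb'q, hQ, hc ▸ hc'⟩
  have hiff : IsGDrazinInvertible (a + b) ↔ IsGDrazinInvertible c := by
    refine ⟨fun ⟨u, hu⟩ => ?_, fun ⟨c', hc'⟩ => ⟨_, (hT hc').isGDrazinInverse_add⟩⟩
    rw [hc]
    -- The restriction of `a + b` to the range of `specIdem a` is invertible unconditionally.
    have hy := hQ.isGDrazinInverse_add
    rw [← add_mul] at hy
    exact hu.corestrict_of_restrict hpi hcm ⟨_, hy⟩
  have hswap : IsGDrazinInvertible c ↔ IsGDrazinInvertible ((a + b) * (a * gDrazin a)) := by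
    rw [hc]
    exact ⟨fun h => h.mul_swap, fun h => h.mul_swap⟩
  refine ⟨hiff, hswap, ?_, fun hab' => ?_⟩
  · rw [← hcm, ← hc]; exact hswap.symm
  · have hS := hT (hiff.1 hab').isGDrazinInverse_gDrazin
    have hs := hS.summable_norm.of_norm
    have h3 := hS.summable_double_corner
    have h6 := hS.isGDrazinInverse_add.gDrazin_eq
    rw [← hc] at h3 h6
    refine ⟨hs, ?_, h3, hS.summable_spec, hS.summable_double_spec, h6⟩
    exact (hs.mul_right b).mul_right (gDrazin c)
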